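/- Call two power series $g,h\in\mathbb{R}[[x,y]]$ right equivalent if $\varphi(g)=h$ for some $\mathbb{R}$-algebra automorphism $\varphi$ of $\mathbb{R}[[x,y]]$. For integers $r,s>4$, say that $g\in\mathbb{R}[[x,y]]$ is of real main type $Y_{r,s}$ if $g$ is right equivalent to $\varepsilon_1x^2y^2+\varepsilon_2x^r+ay^s$ for some signs $\varepsilon_1,\varepsilon_2\in\{1,-1\}$ and some real $a\neq 0$. Let $f\in\mathbb{Q}[x,y]$ be of real main type $Y_{r,s}$ (regarded as an element of $\mathbb{R}[[x,y]]$). If the $4$-jet of $f$, that is, the sum of its terms of total degree at most $4$, does not factorize into linear factors over $\mathbb{Q}$ (that is, it is not a rational constant times a product of polynomials of degree one in $\mathbb{Q}[x,y]$), then $r=s$; that is, $f$ is of real main type $Y_{r,r}$. -/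

import Mathlib

/-- Right equivalence of formal power series over `K`: `φ(f) = g` for some `K`-algebra
automorphism `φ` of the power series ring. -/
def RightEquivalent {ι K : Type*} [Field K] (f g : MvPowerSeries ι K) : Prop :=
  ∃ φ : MvPowerSeries ι K ≃ₐ[K] MvPowerSeries ι K, φ f = g

/-- The `j`-jet of a polynomial: the sum of its homogeneous parts of degree at most `j`. -/
noncomputable def jet {ι K : Type*} [Field K] (f : MvPolynomial ι K) (j : ℕ) :
    MvPolynomial ι K :=
  ∑ i ∈ Finset.range (j + 1), MvPolynomial.homogeneousComponent i f

/-- `p` is a constant times a product of polynomials of degree one over `K`. -/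
def FactorsIntoLinear {ι K : Type*} [Field K] (p : MvPolynomial ι K) : Prop :=
  ∃ (c : K) (L : Multiset (MvPolynomial ι K)),
    (∀ l ∈ L, l.totalDegree = 1) ∧ p = MvPolynomial.C c * L.prod

/-- The polynomial `ε₁ x² y² + ε₂ x ^ r + a y ^ s` in `ℝ[x, y]`. For `ε₁, ε₂ ∈ {1, -1}` this is
Arnold's normal form of one of the four real subtypes of `Y_{r,s}`, with parameter `a`. -/
noncomputable def normalFormY (r s : ℕ) (ε₁ ε₂ a : ℝ) : MvPolynomial (Fin 2) ℝ :=
  MvPolynomial.C ε₁ * MvPolynomial.X 0 ^ 2 * MvPolynomial.X 1 ^ 2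
    + MvPolynomial.C ε₂ * MvPolynomial.X 0 ^ r
    + MvPolynomial.C a * MvPolynomial.X 1 ^ s

/-- A real power series in two variables is of real main type `Y_{r,s}` (where `r, s > 4`) if it
is right equivalent over `ℝ` to `± x² y² ± x ^ r + a y ^ s` for some choice of the two signs and
some real `a ≠ 0`. -/
def IsRealMainTypeY (r s : ℕ) (f : MvPowerSeries (Fin 2) ℝ) : Prop :=
  4 < r ∧ 4 < s ∧ ∃ ε₁ ε₂ a : ℝ, (ε₁ = 1 ∨ ε₁ = -1) ∧ (ε₂ = 1 ∨ ε₂ = -1) ∧ a ≠ 0 ∧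
    RightEquivalent f (normalFormY r s ε₁ ε₂ a : MvPowerSeries (Fin 2) ℝ)

/-- A rational polynomial regarded as a real power series. -/
noncomputable def toRealSeries {ι : Type*} (f : MvPolynomial ι ℚ) : MvPowerSeries ι ℝ :=
  (MvPolynomial.map (algebraMap ℚ ℝ) f : MvPolynomial ι ℝ)

/-! Pulling back the normal form gives f = e u²v² + b u^r + a v^s in real coordinates u, v. The
4-jet of f is then e times the squared product of the linear parts of u and v. If it does not split
over ℚ, the slopes of these parts are irrational and conjugate
(`conjugate_slopes_of_not_factorsIntoLinear`). Two embeddings τ₁, τ₂ of ℝ into a field L exchange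
the slopes (`exists_conjugate_embeddings`) and agree on f, which is rational. Over L, f thus has two
presentations with exponents r, s, in which τ₁u is tangent to a multiple of τ₂v and τ₁v to one of
τ₂u.

If r ≠ s, restrict both to the first-order neighbourhood of the axis on which one presentation is a
pure power with the larger exponent j. In the other, let U be the coordinate that carries the
smaller exponent i; it has order 1 on the axis, and the other coordinate V has order at least 2. The
derivative across the axis forces V to have order at least i - 2, so b U^i is the only term of order
i on the axis and cannot cancel (`order_contradiction`). -/

/-! ### Power series over the dual numbers and the order comparison -/

section DualNumberSeries

open DualNumber

theorem add_mul_pow_succ_of_sq_eq_zero {R : Type*} [CommRing R] {E : R} (hE : E * E = 0)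
    (x y : R) (n : ℕ) : (x + E * y) ^ (n + 1) = x ^ (n + 1) + E * ((n + 1) * x ^ n * y) := by
  induction n with
  | zero => simp
  | succ n ih =>
    rw [pow_succ, ih]
    push_cast
    linear_combination ((n + 1) * x ^ n * y * y) * hE

/-- The canonical inclusion of `L⟦t⟧` into the power series over the dual numbers. -/
noncomputable abbrev dualIncl (L : Type*) [Field L] : PowerSeries L →+* PowerSeries L[ε] :=
  PowerSeries.map (algebraMap L L[ε])

/-- The dual number `ε` as a constant power series. -/
noncomputable abbrev dualEps (L : Type*) [Field L] : PowerSeries L[ε] :=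
  PowerSeries.C (ε : L[ε])

variable {L : Type*} [Field L]

theorem dualEps_mul_self : dualEps L * dualEps L = 0 := by
  rw [dualEps, ← map_mul, DualNumber.eps_mul_eps, map_zero]

theorem exists_eq_dualIncl_add (w : PowerSeries L[ε]) :
    ∃ P Q : PowerSeries L, w = dualIncl L P + dualEps L * dualIncl L Q := by
  refine ⟨PowerSeries.mk fun n => (PowerSeries.coeff n w).fst,
    PowerSeries.mk fun n => (PowerSeries.coeff n w).snd, ?_⟩
  ext n <;> simp [PowerSeries.coeff_C_mul, TrivSqZeroExt.algebraMap_eq_inl']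

theorem dualIncl_add_inj {P Q P' Q' : PowerSeries L}
    (h : dualIncl L P + dualEps L * dualIncl L Q = dualIncl L P' + dualEps L * dualIncl L Q') :
    P = P' ∧ Q = Q' := by
  constructor <;> ext n
  · have := congrArg (fun w => (PowerSeries.coeff n w).fst) h
    simpa [PowerSeries.coeff_C_mul, TrivSqZeroExt.algebraMap_eq_inl'] using this
  · have := congrArg (fun w => (PowerSeries.coeff n w).snd) h
    simpa [PowerSeries.coeff_C_mul, TrivSqZeroExt.algebraMap_eq_inl'] using this

/-- Since ε² = 0, the squared ideal is generated by X² and Xε. -/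
theorem exists_of_mem_span_X_dualEps_sq {w : PowerSeries L[ε]}
    (hw : w ∈ Ideal.span {PowerSeries.X, dualEps L} ^ 2) :
    ∃ P Q : PowerSeries L, w = dualIncl L (PowerSeries.X ^ 2 * P)
      + dualEps L * dualIncl L (PowerSeries.X * Q) := by
  rw [pow_two, Ideal.span_pair_mul_span_pair, dualEps_mul_self] at hw
  obtain ⟨a, b, c, d, rfl⟩ : ∃ a b c d, w = a * (PowerSeries.X * PowerSeries.X)
      + b * (PowerSeries.X * dualEps L) + c * (dualEps L * PowerSeries.X) + d * 0 := by
    simp only [Ideal.mem_span_insert, Ideal.mem_span_singleton'] at hw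
    obtain ⟨a, _, ⟨b, _, ⟨c, _, ⟨d, rfl⟩, rfl⟩, rfl⟩, rfl⟩ := hw
    exact ⟨a, b, c, d, by ring⟩
  obtain ⟨A, B, rfl⟩ := exists_eq_dualIncl_add a
  obtain ⟨A', B', hA'⟩ := exists_eq_dualIncl_add (b + c)
  refine ⟨A, PowerSeries.X * B + A', ?_⟩
  have hX : dualIncl L PowerSeries.X = PowerSeries.X := PowerSeries.map_X _
  simp only [map_mul, map_add, map_pow, hX]
  linear_combination (PowerSeries.X * dualEps L) * hA'
    + (PowerSeries.X * dualIncl L B') * dualEps_mul_self (L := L)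

open PowerSeries in
/-- The order comparison at the heart of the argument: the equations express that a coordinate
change tangent to the identity maps a normal form with exponents `k + 5` and `k + l + 6` to one
in which they are interchanged, modulo the square of the second variable. -/
theorem order_contradiction [CharZero L] (k l : ℕ) {e b a b' κ κ' : L} (he : e ≠ 0) (hb : b ≠ 0)
    (hκ : κ ≠ 0) (hκ' : κ' ≠ 0) (p q s T : PowerSeries L)
    (hp : constantCoeff p = κ) (hT : constantCoeff T = κ')
    (h0 : C e * ((X * p) ^ 2 * (X ^ 2 * s) ^ 2) + C b * (X * p) ^ (k + 5)
      + C a * (X ^ 2 * s) ^ (k + l + 6) = C b' * X ^ (k + l + 6))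
    (h1 : C e * (2 * (X * p) * (X * q) * (X ^ 2 * s) ^ 2 + 2 * (X * p) ^ 2 * (X ^ 2 * s) * T)
      + C b * (((k : PowerSeries L) + 5) * (X * p) ^ (k + 4) * (X * q))
      + C a * (((k : PowerSeries L) + (l : PowerSeries L) + 6) * (X ^ 2 * s) ^ (k + l + 5) * T) = 0) : False := by
  -- After division of `h1` by X⁴, `W` is the cofactor of `s`. Its constant term 2eκ²κ' is nonzero,
  -- so `s` inherits the factor X^(k+1) of the remaining term.
  set W : PowerSeries L := 2 * C e * p ^ 2 * T + X * (X * (2 * C e * p * q * s)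
    + C a * ((k : PowerSeries L) + (l : PowerSeries L) + 6) * X ^ (2 * k + 2 * l + 5) * s ^ (k + l + 4) * T) with hW
  have hWu : IsUnit W := by
    rw [isUnit_iff_constantCoeff, isUnit_iff_ne_zero, hW]
    have h2 : constantCoeff (2 : PowerSeries L) = 2 := map_ofNat _ 2
    simp [hp, hT, he, hκ, hκ', h2]
  have hX4 : (X : PowerSeries L) ^ 4 ≠ 0 := pow_ne_zero _ X_ne_zero
  have hsW : s * W = X ^ (k + 1) * (-(C b * ((k : PowerSeries L) + 5) * p ^ (k + 4) * q)) := by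
    apply mul_left_cancel₀ hX4
    rw [hW]
    simp only [mul_pow, ← pow_mul] at h1
    linear_combination (exp := 1) h1
  obtain ⟨W', hW'⟩ := hWu.exists_right_inv
  obtain ⟨s', rfl⟩ : ∃ s', s = X ^ (k + 1) * s' :=
    ⟨-(C b * ((k : PowerSeries L) + 5) * p ^ (k + 4) * q) * W', by linear_combination W' * hsW - s * hW'⟩
  have hXk : (X : PowerSeries L) ^ (k + 5) ≠ 0 := pow_ne_zero _ X_ne_zero
  -- `h0` divided by X^(k+5): every term but the first keeps a factor X, while the first has
  -- constant term bκ^(k+5) ≠ 0.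
  have hfin : C b * p ^ (k + 5) = X * (C b' * X ^ l - C e * (X ^ (k + 2) * p ^ 2 * s' ^ 2)
      - C a * (X ^ (k + 2 * l + 6) * (X ^ (k + 1) * s') ^ (k + l + 6))) := by
    apply mul_left_cancel₀ hXk
    simp only [mul_pow _ _ (k + 5), mul_pow (X ^ 2) _ (k + l + 6), ← pow_mul X 2] at h0
    linear_combination (exp := 1) h0
  have := congrArg constantCoeff hfin
  simp [hp, hb, hκ] at this

open PowerSeries in
theorem dual_number_contradiction [CharZero L] {i j : ℕ} (hi : 4 < i) (hij : i < j)
    {e b a b' κ κ' : L} (he : e ≠ 0) (hb : b ≠ 0) (hκ : κ ≠ 0) (hκ' : κ' ≠ 0)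
    {U V : PowerSeries L[ε]}
    (hU : U - dualIncl L (C κ) * X ∈ Ideal.span {X, dualEps L} ^ 2)
    (hV : V - dualIncl L (C κ') * dualEps L ∈ Ideal.span {X, dualEps L} ^ 2)
    (h : dualIncl L (C e) * (U ^ 2 * V ^ 2) + dualIncl L (C b) * U ^ i + dualIncl L (C a) * V ^ j
      = dualIncl L (C b') * X ^ j) : False := by
  obtain ⟨k, rfl⟩ : ∃ k, i = k + 5 := ⟨i - 5, by omega⟩
  obtain ⟨l, rfl⟩ : ∃ l, j = k + l + 6 := ⟨j - (k + 6), by omega⟩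
  obtain ⟨p, q, hpq⟩ := exists_of_mem_span_X_dualEps_sq hU
  obtain ⟨s, w, hsw⟩ := exists_of_mem_span_X_dualEps_sq hV
  have hX : dualIncl L X = X := PowerSeries.map_X _
  have hU' : U = dualIncl L (X * (C κ + X * p)) + dualEps L * dualIncl L (X * q) := by
    simp only [map_mul, map_add, map_pow, hX] at hpq ⊢
    linear_combination hpq
  have hV' : V = dualIncl L (X ^ 2 * s) + dualEps L * dualIncl L (C κ' + X * w) := by
    simp only [map_mul, map_add, map_pow, hX] at hsw ⊢
    linear_combination hsw
  set P := X * (C κ + X * p) with hP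
  set T := C κ' + X * w with hT
  have hE := dualEps_mul_self (L := L)
  have key : dualIncl L (C e * (P ^ 2 * (X ^ 2 * s) ^ 2) + C b * P ^ (k + 5)
      + C a * (X ^ 2 * s) ^ (k + l + 6)) + dualEps L * dualIncl L
      (C e * (2 * P * (X * q) * (X ^ 2 * s) ^ 2 + 2 * P ^ 2 * (X ^ 2 * s) * T)
      + C b * (((k : PowerSeries L) + 5) * P ^ (k + 4) * (X * q))
      + C a * (((k : PowerSeries L) + (l : PowerSeries L) + 6) * (X ^ 2 * s) ^ (k + l + 5) * T))
      = dualIncl L (C b' * X ^ (k + l + 6)) + dualEps L * dualIncl L 0 := by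
    have e1 := add_mul_pow_succ_of_sq_eq_zero hE (dualIncl L P) (dualIncl L (X * q)) 1
    have e2 := add_mul_pow_succ_of_sq_eq_zero hE (dualIncl L (X ^ 2 * s)) (dualIncl L T) 1
    have e3 := add_mul_pow_succ_of_sq_eq_zero hE (dualIncl L P) (dualIncl L (X * q)) (k + 4)
    have e4 := add_mul_pow_succ_of_sq_eq_zero hE (dualIncl L (X ^ 2 * s)) (dualIncl L T) (k + l + 5)
    rw [← hU'] at e1 e3
    rw [← hV'] at e2 e4
    norm_num only at e1 e2
    rw [show k + 4 + 1 = k + 5 from rfl] at e3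
    rw [show k + l + 5 + 1 = k + l + 6 from rfl] at e4
    rw [e1, e2, e3, e4] at h
    push_cast at h
    simp only [map_mul, map_add, map_pow, map_natCast, map_ofNat, map_zero, hX] at h ⊢
    -- The ε² cross term of U²V² is removed.
    linear_combination h - dualIncl L (C e) * (4 * dualIncl L P * X * dualIncl L q * (X ^ 2 * dualIncl L s)
      * dualIncl L T) * hE
  obtain ⟨h0, h1⟩ := dualIncl_add_inj key
  exact order_contradiction k l he hb hκ hκ' (C κ + X * p) q s T (by simp) (by simp [hT]) h0 h1

end DualNumberSeries

/-! ### Automorphisms of the power series ring in two variables -/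

section TwoVariables

open MvPowerSeries

/-- The ideal of `R⟦x, y⟧` generated by the two variables. -/
noncomputable abbrev varIdeal (R : Type*) [CommRing R] : Ideal (MvPowerSeries (Fin 2) R) :=
  Ideal.span {X 0, X 1}

theorem exists_eq_C_add_X_mul_add_X_mul {R : Type*} [CommRing R] (f : MvPowerSeries (Fin 2) R) :
    ∃ g h, f = C (constantCoeff f) + X 0 * g + X 1 * h := by
  classical
  -- `f₀` collects the monomials that involve x; what is left, apart from the constant, is divisible
  -- by y.
  let f₀ : MvPowerSeries (Fin 2) R := fun d => if d 0 = 0 then 0 else coeff d f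
  have hf₀ (d) : coeff d f₀ = if d 0 = 0 then 0 else coeff d f := rfl
  obtain ⟨g, hg⟩ : X 0 ∣ f₀ := X_dvd_iff.2 fun d hd => by rw [hf₀, if_pos hd]
  obtain ⟨h, hh⟩ : X 1 ∣ f - C (constantCoeff f) - f₀ := by
    refine X_dvd_iff.2 fun d hd => ?_
    rw [map_sub, map_sub, hf₀, coeff_C]
    by_cases h0 : d 0 = 0
    · have : d = 0 := by ext i; fin_cases i <;> simp [h0, hd]
      simp [this]
    · have : d ≠ 0 := by rintro rfl; exact h0 rfl
      simp [h0, this]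
  exact ⟨g, h, by linear_combination hg + hh⟩

theorem mem_varIdeal_iff {R : Type*} [CommRing R] {f : MvPowerSeries (Fin 2) R} :
    f ∈ varIdeal R ↔ constantCoeff f = 0 := by
  refine ⟨fun h => ?_, fun h => ?_⟩
  · obtain ⟨a, b, rfl⟩ := Ideal.mem_span_pair.1 h
    simp
  · obtain ⟨g, k, hf⟩ := exists_eq_C_add_X_mul_add_X_mul f
    rw [hf, h, map_zero, zero_add]
    exact Ideal.mem_span_pair.2 ⟨g, k, by ring⟩

theorem exists_linear_part {R : Type*} [CommRing R] {f : MvPowerSeries (Fin 2) R}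
    (hf : constantCoeff f = 0) :
    ∃ α β : R, f - (C α * X 0 + C β * X 1) ∈ varIdeal R ^ 2 := by
  obtain ⟨g, h, hgh⟩ := exists_eq_C_add_X_mul_add_X_mul f
  refine ⟨constantCoeff g, constantCoeff h, ?_⟩
  have : f - (C (constantCoeff g) * X 0 + C (constantCoeff h) * X 1) =
      X 0 * (g - C (constantCoeff g)) + X 1 * (h - C (constantCoeff h)) := by
    rw [hf, map_zero] at hgh
    linear_combination hgh
  rw [this, pow_two]
  refine add_mem (Ideal.mul_mem_mul (Ideal.subset_span (by simp)) ?_)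
    (Ideal.mul_mem_mul (Ideal.subset_span (by simp)) ?_) <;>
  simp [mem_varIdeal_iff]

theorem le_order_of_mem_varIdeal_pow {R : Type*} [CommRing R] {n : ℕ}
    {f : MvPowerSeries (Fin 2) R} (hf : f ∈ varIdeal R ^ n) : (n : ℕ∞) ≤ f.order := by
  induction n generalizing f with
  | zero => simp
  | succ n ih =>
    rw [pow_succ] at hf
    refine Submodule.mul_induction_on hf (fun a ha b hb => ?_) fun a b ha hb =>
      (le_min ha hb).trans min_order_le_add
    have hb' : 1 ≤ b.order := one_le_order_iff_constCoeff_eq_zero.2 (mem_varIdeal_iff.1 hb)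
    push_cast
    exact (add_le_add (ih ha) hb').trans le_order_mul

theorem map_varIdeal_pow_le {R A : Type*} [CommRing R] [CommRing A]
    (g : MvPowerSeries (Fin 2) R →+* A) {I : Ideal A} (h0 : g (X 0) ∈ I) (h1 : g (X 1) ∈ I)
    {n : ℕ} {f : MvPowerSeries (Fin 2) R} (hf : f ∈ varIdeal R ^ n) : g f ∈ I ^ n := by
  have h : (varIdeal R).map g ≤ I := by
    rw [Ideal.map_span, Ideal.span_le]
    rintro _ ⟨x, hx | hx, rfl⟩
    · rwa [hx]
    · rwa [hx]
  exact Ideal.pow_right_mono h n (Ideal.map_pow g (varIdeal R) n ▸ Ideal.mem_map_of_mem g hf)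

/-- No continuity is assumed: writing f = f(0) + xg + yh repeatedly puts the difference of the two
images in every power of the ideal (x, y), and these powers intersect in 0. -/
theorem algHom_eq_of_eq_X {R : Type*} [CommRing R]
    {φ ψ : MvPowerSeries (Fin 2) R →ₐ[R] MvPowerSeries (Fin 2) R}
    (hφ : ∀ i, constantCoeff (φ (X i)) = 0) (h : ∀ i, φ (X i) = ψ (X i)) : φ = ψ := by
  have key (n : ℕ) : ∀ f, φ f - ψ f ∈ varIdeal R ^ n := by
    induction n with
    | zero => simp
    | succ n ih =>
      intro f
      obtain ⟨a, b, hf⟩ := exists_eq_C_add_X_mul_add_X_mul f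
      have : φ f - ψ f = φ (X 0) * (φ a - ψ a) + φ (X 1) * (φ b - ψ b) := by
        have hC : φ (C (constantCoeff f)) = ψ (C (constantCoeff f)) :=
          (φ.commutes _).trans (ψ.commutes _).symm
        have h1 := congrArg φ hf
        have h2 := congrArg ψ hf
        simp only [map_add, map_mul, ← h, ← hC] at h1 h2
        linear_combination h1 - h2
      rw [this, pow_succ']
      exact add_mem (Ideal.mul_mem_mul (mem_varIdeal_iff.2 (hφ 0)) (ih a))
        (Ideal.mul_mem_mul (mem_varIdeal_iff.2 (hφ 1)) (ih b))
  ext f d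
  rw [← sub_eq_zero, ← map_sub]
  refine coeff_of_lt_order (lt_of_lt_of_le ?_ (le_order_of_mem_varIdeal_pow (key (d.degree + 1) f)))
  exact_mod_cast Nat.lt_succ_self _

theorem constantCoeff_algEquiv_X {K σ : Type*} [Field K]
    (φ : MvPowerSeries σ K ≃ₐ[K] MvPowerSeries σ K) (i : σ) : constantCoeff (φ (X i)) = 0 := by
  by_contra h
  have h1 : IsUnit (φ (X i)) := isUnit_iff_constantCoeff.2 (isUnit_iff_ne_zero.2 h)
  have h2 : IsUnit (X i : MvPowerSeries σ K) := by simpa using h1.map φ.symm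
  simpa using isUnit_iff_constantCoeff.1 h2

/-- As a substitution, φ can be transported along a field embedding by mapping the series `φ (X i)`.
-/
theorem algEquiv_eq_subst {K : Type*} [Field K]
    (φ : MvPowerSeries (Fin 2) K ≃ₐ[K] MvPowerSeries (Fin 2) K) (f : MvPowerSeries (Fin 2) K) :
    φ f = subst (fun i => φ (X i)) f := by
  have ha : HasSubst (fun i => φ (X i)) :=
    hasSubst_of_constantCoeff_zero (constantCoeff_algEquiv_X φ)
  have : (φ : MvPowerSeries (Fin 2) K →ₐ[K] MvPowerSeries (Fin 2) K) = substAlgHom ha :=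
    algHom_eq_of_eq_X (constantCoeff_algEquiv_X φ) fun i => by simp [subst_X ha]
  rw [← substAlgHom_apply ha, ← this]
  rfl

open DualNumber in
theorem exponents_eq_of_swap {K L : Type*} [Field K] [Field L] [CharZero L] (τ₁ τ₂ : K →+* L)
    (φ : MvPowerSeries (Fin 2) K ≃ₐ[K] MvPowerSeries (Fin 2) K) {r s : ℕ} (hr : 4 < r) (hs : 4 < s)
    {e b a : K} (he : e ≠ 0) (hb : b ≠ 0) (ha : a ≠ 0) (hτe : τ₁ e = τ₂ e)
    {u v F : MvPowerSeries (Fin 2) K} (hu : φ u = X 0) (hv : φ v = X 1)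
    (hF : F = C e * (u ^ 2 * v ^ 2) + C b * u ^ r + C a * v ^ s) (hτF : map τ₁ F = map τ₂ F)
    {κ κ' : L} (hκ : κ ≠ 0) (hκ' : κ' ≠ 0)
    (huv : map τ₁ u - C κ * map τ₂ v ∈ varIdeal L ^ 2)
    (hvu : map τ₁ v - C κ' * map τ₂ u ∈ varIdeal L ^ 2) : r = s := by
  have hφs : HasSubst (fun i => φ (X i)) :=
    hasSubst_of_constantCoeff_zero (constantCoeff_algEquiv_X φ)
  have hφτ : HasSubst (fun i => map τ₂ (φ (X i))) := hφs.map τ₂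
  have hτinj₁ (x : K) (hx : x ≠ 0) : τ₁ x ≠ 0 := by simpa using hx
  have key (z : Fin 2 → PowerSeries L[ε])
      (hz : ∀ i, z i ∈ Ideal.span {PowerSeries.X, dualEps L})
      (hzs : HasSubst (S := L[ε]) (τ := Unit) z) :
      ∃ U V : PowerSeries L[ε],
        U - dualIncl L (PowerSeries.C κ) * z 1 ∈ Ideal.span {PowerSeries.X, dualEps L} ^ 2 ∧
        V - dualIncl L (PowerSeries.C κ') * z 0 ∈ Ideal.span {PowerSeries.X, dualEps L} ^ 2 ∧
        dualIncl L (PowerSeries.C (τ₁ e)) * (U ^ 2 * V ^ 2)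
          + dualIncl L (PowerSeries.C (τ₁ b)) * U ^ r + dualIncl L (PowerSeries.C (τ₁ a)) * V ^ s
        = dualIncl L (PowerSeries.C (τ₁ e)) * (z 0 ^ 2 * z 1 ^ 2)
          + dualIncl L (PowerSeries.C (τ₂ b)) * z 0 ^ r
          + dualIncl L (PowerSeries.C (τ₂ a)) * z 1 ^ s := by
    -- `Θ` evaluates a series at the point whose coordinates τ₂u, τ₂v are `z 0`, `z 1`.
    let Θ : MvPowerSeries (Fin 2) L →ₐ[L] PowerSeries L[ε] :=
      (substAlgHom (R := L) hzs).comp (substAlgHom (R := L) hφτ)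
    have hΘC (c : L) : Θ (C c) = dualIncl L (PowerSeries.C c) := by
      rw [PowerSeries.map_C]
      exact (Θ.commutes c).trans MvPowerSeries.algebraMap_apply
    have hΘτ (w : MvPowerSeries (Fin 2) K) : Θ (map τ₂ w) = subst z (map τ₂ (φ w)) := by
      rw [algEquiv_eq_subst φ w, map_subst hφs]
      simp [Θ]
    have hΘu : Θ (map τ₂ u) = z 0 := by rw [hΘτ, hu, map_X, subst_X hzs]
    have hΘv : Θ (map τ₂ v) = z 1 := by rw [hΘτ, hv, map_X, subst_X hzs]
    have hΘX (i : Fin 2) : Θ (X i) ∈ Ideal.span {PowerSeries.X, dualEps L} := by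
      have h1 : Θ (X i) = substAlgHom (R := L) hzs (map τ₂ (φ (X i))) := by
        simp [Θ, subst_X hφτ]
      have h2 : map τ₂ (φ (X i)) ∈ varIdeal L ^ 1 := by
        rw [pow_one, mem_varIdeal_iff, constantCoeff_map, constantCoeff_algEquiv_X, map_zero]
      rw [h1]
      have h3 := map_varIdeal_pow_le (substAlgHom (R := L) hzs : _ →+* PowerSeries L[ε])
        (I := Ideal.span {PowerSeries.X, dualEps L})
        (by simpa [subst_X hzs] using hz 0) (by simpa [subst_X hzs] using hz 1) h2
      simpa using h3
    have hΘI {w} (hw : w ∈ varIdeal L ^ 2) :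
        Θ w ∈ Ideal.span {PowerSeries.X, dualEps L} ^ 2 :=
      map_varIdeal_pow_le (Θ : _ →+* PowerSeries L[ε]) (hΘX 0) (hΘX 1) hw
    refine ⟨Θ (map τ₁ u), Θ (map τ₁ v), ?_, ?_, ?_⟩
    · simpa only [map_sub, map_mul, hΘC, hΘv] using hΘI huv
    · simpa only [map_sub, map_mul, hΘC, hΘu] using hΘI hvu
    · have := congrArg Θ hτF
      simp only [hF, map_add, map_mul, map_pow, map_C, hΘC, hΘu, hΘv] at this
      rw [this, hτe]
  have hX : (PowerSeries.X : PowerSeries L[ε]) ∈ Ideal.span {PowerSeries.X, dualEps L} :=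
    Ideal.subset_span (by simp)
  have hε : dualEps L ∈ Ideal.span {PowerSeries.X, dualEps L} := Ideal.subset_span (by simp)
  have hXn : IsNilpotent (constantCoeff (PowerSeries.X : MvPowerSeries Unit L[ε])) := by
    have : constantCoeff (PowerSeries.X : MvPowerSeries Unit L[ε]) = 0 :=
      PowerSeries.constantCoeff_X
    rw [this]
    exact IsNilpotent.zero
  have hεn : IsNilpotent (constantCoeff (dualEps L : MvPowerSeries Unit L[ε])) := by
    have : constantCoeff (dualEps L : MvPowerSeries Unit L[ε]) = ε :=
      PowerSeries.constantCoeff_C _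
    rw [this]
    exact ⟨2, by rw [pow_two, DualNumber.eps_mul_eps]⟩
  have hE := dualEps_mul_self (L := L)
  have hE2 (n : ℕ) (hn : 4 < n) : dualEps L ^ n = 0 := by
    obtain ⟨k, rfl⟩ : ∃ k, n = k + 2 := ⟨n - 2, by omega⟩
    rw [pow_add, pow_two, hE, mul_zero]
  refine le_antisymm (not_lt.1 fun h => ?_) (not_lt.1 fun h => ?_)
  -- Here s < r. On the thickened axis (X, ε) the terms with z₁² or z₁^s vanish, which leaves X^r.
  -- As V is tangent to κ'X and carries the smaller exponent s, the roles of U and V are exchanged.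
  · obtain ⟨U, V, hU, hV, hUV⟩ := key ![PowerSeries.X, dualEps L]
      (fun i => by fin_cases i; exacts [hX, hε])
      (hasSubst_of_constantCoeff_nilpotent fun i => by fin_cases i; exacts [hXn, hεn])
    refine dual_number_contradiction hs h (hτinj₁ e he) (hτinj₁ a ha) hκ' hκ (U := V) (V := U)
      (a := τ₁ b) (b' := τ₂ b) hV hU ?_
    simp only [Matrix.cons_val_zero, Matrix.cons_val_one] at hUV
    rw [hE2 s hs] at hUV
    linear_combination hUV + dualIncl L (PowerSeries.C (τ₁ e)) * PowerSeries.X ^ 2 * hE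
  · obtain ⟨U, V, hU, hV, hUV⟩ := key ![dualEps L, PowerSeries.X]
      (fun i => by fin_cases i; exacts [hε, hX])
      (hasSubst_of_constantCoeff_nilpotent fun i => by fin_cases i; exacts [hεn, hXn])
    refine dual_number_contradiction hr h (hτinj₁ e he) (hτinj₁ b hb) hκ hκ'
      (a := τ₁ a) (b' := τ₂ a) hU hV ?_
    simp only [Matrix.cons_val_zero, Matrix.cons_val_one] at hUV
    rw [hE2 r hr] at hUV
    linear_combination hUV + dualIncl L (PowerSeries.C (τ₁ e)) * PowerSeries.X ^ 2 * hE

end TwoVariables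

/-! ### Conjugate embeddings of ℝ -/

section Amalgamation

open TensorProduct

/-- The tensor product over K is nonzero, so a residue field of it serves. A larger field is needed
because ℝ has no nontrivial automorphism. -/
theorem exists_field_amalgam {K A B : Type} [Field K] [Field A] [Field B] (i : K →+* A)
    (j : K →+* B) : ∃ (L : Type) (_ : Field L) (f : A →+* L) (g : B →+* L),
      ∀ x, f (i x) = g (j x) := by
  let := i.toAlgebra
  let := j.toAlgebra
  obtain ⟨M, hM⟩ := Ideal.exists_maximal (A ⊗[K] B)
  refine ⟨(A ⊗[K] B) ⧸ M, Ideal.Quotient.field M,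
    (Ideal.Quotient.mk M).comp Algebra.TensorProduct.includeLeftRingHom,
    (Ideal.Quotient.mk M).comp
      (Algebra.TensorProduct.includeRight : B →ₐ[K] A ⊗[K] B).toRingHom, fun x => ?_⟩
  have h : (algebraMap K A x) ⊗ₜ[K] (1 : B) = (1 : A) ⊗ₜ[K] (algebraMap K B x) := by
    rw [Algebra.algebraMap_eq_smul_one, Algebra.algebraMap_eq_smul_one, TensorProduct.smul_tmul]
  exact congrArg (Ideal.Quotient.mk M) h

open Polynomial in
/-- Two embeddings of `ℝ` into a common field that realise the conjugation of the two roots of a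
rational quadratic polynomial. -/
theorem exists_conjugate_embeddings {m n : ℝ} {p q : ℚ} (hadd : m + n = p) (hmul : m * n = q)
    (hm : Irrational m) : ∃ (L : Type) (_ : Field L) (τ₁ τ₂ : ℝ →+* L),
      τ₁ m = τ₂ n ∧ τ₁ n = τ₂ m := by
  set P : ℚ[X] := X ^ 2 + (C (-p) * X + C q) with hP
  have hdeg : (C (-p) * X + C q).degree < ((2 : ℕ) : WithBot ℕ) :=
    degree_linear_lt
  have hmonic : P.Monic := monic_X_pow_add hdeg
  have hnat : P.natDegree = 2 := by rw [hP]; compute_degree!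
  have hirr : Irreducible P := by
    rw [hmonic.irreducible_iff_roots_eq_zero_of_degree_le_three hnat.ge (by omega),
      Multiset.eq_zero_iff_forall_notMem]
    intro x hx
    have hx := (mem_roots'.1 hx).2
    have hx' : x ^ 2 - p * x + q = 0 := by
      simp [hP, IsRoot] at hx
      linear_combination hx
    have hxR : (x : ℝ) ^ 2 - p * x + q = 0 := by exact_mod_cast hx'
    have hxm : ((x : ℝ) - m) * (x - n) = 0 := by linear_combination hxR + hmul - x * hadd
    rcases mul_eq_zero.1 hxm with h | h
    · exact hm ⟨x, by linarith⟩
    · exact hm ⟨p - x, by push_cast; linarith⟩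
  have : Fact (Irreducible P) := ⟨hirr⟩
  have hroot (x y : ℝ) (hxy : x + y = p) (hxy' : x * y = q) :
      P.eval₂ (algebraMap ℚ ℝ) x = 0 := by
    simp [hP]
    linear_combination x * hxy - hxy'
  obtain ⟨L, hL, τ₁, τ₂, h⟩ := exists_field_amalgam
    (AdjoinRoot.lift (algebraMap ℚ ℝ) m (hroot m n hadd hmul))
    (AdjoinRoot.lift (algebraMap ℚ ℝ) n (hroot n m (by linarith) (by linarith)))
  have h1 := h (AdjoinRoot.root P)
  rw [AdjoinRoot.lift_root, AdjoinRoot.lift_root] at h1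
  refine ⟨L, hL, τ₁, τ₂, h1, ?_⟩
  have h2 : τ₁ n = τ₁ p - τ₁ m := by rw [← map_sub, ← hadd, add_sub_cancel_left]
  have h3 : τ₂ m = τ₂ p - τ₂ n := by rw [← map_sub, ← hadd, add_sub_cancel_right]
  rw [h2, h3, h1, map_ratCast, map_ratCast]

end Amalgamation

/-! ### Rationality of the 4-jet's factors -/

section Jet

open MvPolynomial

theorem coeff_jet {ι K : Type*} [Field K] (f : MvPolynomial ι K) (j : ℕ) (d : ι →₀ ℕ) :
    coeff d (jet f j) = if d.degree ≤ j then coeff d f else 0 := by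
  classical
  simp [jet, coeff_sum, coeff_homogeneousComponent]

theorem totalDegree_C_mul_X_add {K : Type*} [Field K] (a b : K) (h : a ≠ 0 ∨ b ≠ 0) :
    (C a * X 0 + C b * X 1 : MvPolynomial (Fin 2) K).totalDegree = 1 := by
  refine IsHomogeneous.totalDegree (((isHomogeneous_C_mul_X _ _)).add (isHomogeneous_C_mul_X _ _))
    fun h0 => ?_
  rcases h with h | h
  · exact h (by simpa using congrArg (eval ![1, 0]) h0)
  · exact h (by simpa using congrArg (eval ![0, 1]) h0)

theorem factorsIntoLinear_of_eq {K : Type*} [Field K] {q : MvPolynomial (Fin 2) K}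
    (k a b c d : K) (hab : a ≠ 0 ∨ b ≠ 0) (hcd : c ≠ 0 ∨ d ≠ 0)
    (hq : q = C k * ((C a * X 0 + C b * X 1) * (C c * X 0 + C d * X 1)) ^ 2) :
    FactorsIntoLinear q := by
  refine ⟨k, {C a * X 0 + C b * X 1, C a * X 0 + C b * X 1, C c * X 0 + C d * X 1,
    C c * X 0 + C d * X 1}, ?_, ?_⟩
  · intro l hl
    simp only [Multiset.insert_eq_cons, Multiset.mem_cons, Multiset.mem_singleton] at hl
    rcases hl with rfl | rfl | rfl | rfl
    all_goals first
      | exact totalDegree_C_mul_X_add a b hab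
      | exact totalDegree_C_mul_X_add c d hcd
  · rw [hq]
    simp only [Multiset.insert_eq_cons, Multiset.prod_cons, Multiset.prod_singleton]
    ring

/-- If a rational quartic form is the square of a product of two real linear forms up to a
rational constant, then it factors into rational linear forms or the two linear forms have
conjugate irrational slopes. -/
theorem conjugate_slopes_of_not_factorsIntoLinear {q : MvPolynomial (Fin 2) ℚ} {e : ℚ}
    (he : e ≠ 0) {α β γ δ : ℝ}
    (hq : map (algebraMap ℚ ℝ) q
      = C (e : ℝ) * ((C α * X 0 + C β * X 1) * (C γ * X 0 + C δ * X 1)) ^ 2)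
    (hfac : ¬ FactorsIntoLinear q) :
    α ≠ 0 ∧ γ ≠ 0 ∧ Irrational (β / α) ∧
      ∃ P Q : ℚ, β / α + δ / γ = P ∧ β / α * (δ / γ) = Q := by
  have hinj : Function.Injective (map (algebraMap ℚ ℝ) : MvPolynomial (Fin 2) ℚ → _) :=
    map_injective _ (algebraMap ℚ ℝ).injective
  have heR : (e : ℝ) ≠ 0 := by exact_mod_cast he
  -- The values at five rational points determine the coefficients A², 2AB, B² + 2AD, 2BD, D² of the
  -- squared form Ax² + Bxy + Dy², so these are rational.
  have hev (x y : ℚ) : ∃ w : ℚ, ((α * x + β * y) * (γ * x + δ * y)) ^ 2 = w := by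
    refine ⟨eval ![x, y] q / e, ?_⟩
    have h1 := congrArg (eval ![(x : ℝ), (y : ℝ)]) hq
    have h2 : eval ![(x : ℝ), (y : ℝ)] (map (algebraMap ℚ ℝ) q) = (eval ![x, y] q : ℚ) := by
      have : ![(x : ℝ), (y : ℝ)] = fun i => algebraMap ℚ ℝ (![x, y] i) := by
        ext i; fin_cases i <;> rfl
      rw [this, eval_map]; exact (eval₂_comp (algebraMap ℚ ℝ) ![x, y] q).symm
    rw [h2] at h1
    push_cast
    rw [h1]
    simp
    field_simp
  obtain ⟨w₀, h₀⟩ := hev 1 0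
  obtain ⟨w₁, h₁⟩ := hev 1 1
  obtain ⟨w₂, h₂⟩ := hev 1 (-1)
  obtain ⟨w₃, h₃⟩ := hev 1 2
  obtain ⟨w₄, h₄⟩ := hev 0 1
  push_cast at h₀ h₁ h₂ h₃ h₄
  set A := α * γ with hA
  set B := α * δ + β * γ with hB
  set D := β * δ with hD
  have hform : (C α * X 0 + C β * X 1) * (C γ * X 0 + C δ * X 1)
      = (C A * X 0 ^ 2 + C B * X 0 * X 1 + C D * X 1 ^ 2 : MvPolynomial (Fin 2) ℝ) := by
    simp only [hA, hB, hD, map_add, map_mul]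
    ring
  have hA2 : A ^ 2 = w₀ := by rw [← h₀]; ring
  have hD2 : D ^ 2 = w₄ := by rw [← h₄]; ring
  obtain ⟨c₂, hc₂⟩ : ∃ c : ℚ, B ^ 2 + 2 * A * D = c :=
    ⟨(w₁ + w₂) / 2 - w₀ - w₄, by push_cast; rw [← h₀, ← h₁, ← h₂, ← h₄]; ring⟩
  obtain ⟨c₃, hc₃⟩ : ∃ c : ℚ, B * D = c := by
    refine ⟨(w₃ - w₀ - 16 * w₄ - 4 * c₂ - (w₁ - w₂)) / 12, ?_⟩
    push_cast
    rw [← h₀, ← h₁, ← h₂, ← h₃, ← h₄, ← hc₂]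
    ring
  obtain ⟨c₁, hc₁⟩ : ∃ c : ℚ, A * B = c := by
    refine ⟨(w₁ - w₂) / 4 - c₃, ?_⟩
    push_cast
    rw [← h₁, ← h₂, ← hc₃]
    ring
  -- If A = 0, the form is y(Bx + Dy), and its square splits over ℚ up to a rational constant.
  have hA0 : A ≠ 0 := by
    intro hA0
    by_cases hD0 : D = 0
    · refine hfac (factorsIntoLinear_of_eq (e * c₂) 1 0 0 1 (by simp) (by simp) (hinj ?_))
      rw [hq, hform, hA0, hD0]
      simp [← hc₂, hD0, hA0]
      ring
    · have hb : B = (c₃ / w₄ : ℚ) * D := by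
        push_cast
        rw [← hc₃, ← hD2]
        field_simp
      refine hfac (factorsIntoLinear_of_eq (e * w₄) (c₃ / w₄) 1 0 1 (by simp) (by simp) (hinj ?_))
      rw [hq, hform, hA0, hb]
      generalize c₃ / w₄ = b
      simp [← hD2]
      ring
  have hα : α ≠ 0 := left_ne_zero_of_mul hA0
  have hγ : γ ≠ 0 := right_ne_zero_of_mul hA0
  have hsum : β / α + δ / γ = (c₁ / w₀ : ℚ) := by
    push_cast
    rw [← hc₁, ← hA2]
    field_simp
    rw [hA, hB]
    ring
  -- The slopes have sum B/A = AB/A² and product D/A, where (B² + 2AD)/A² = (B/A)² + 2D/A.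
  refine ⟨hα, hγ, ?_, c₁ / w₀, (c₂ / w₀ - (c₁ / w₀) ^ 2) / 2, hsum, ?_⟩
  · rintro ⟨ρ, hρ⟩
    set b := c₁ / w₀
    have hβ : β = α * ρ := by rw [hρ]; field_simp
    have hδ : δ = γ * (b - ρ : ℚ) := by
      push_cast
      rw [← hsum, ← hρ]
      field_simp
      ring
    refine hfac (factorsIntoLinear_of_eq (e * w₀) 1 ρ 1 (b - ρ) (by simp) (by simp) (hinj ?_))
    generalize b - ρ = σ at *
    rw [hq, hβ, hδ]
    simp [← hA2, hA]
    ring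
  · push_cast
    rw [← hc₁, ← hc₂, ← hA2, hA, hB, hD]
    field_simp
    ring

end Jet

/-! ### The 4-jet of a series of type Y and the exchange of tangents -/

section MainType

open MvPowerSeries

theorem map_jet_four_eq {f : MvPolynomial (Fin 2) ℚ} {u v : MvPowerSeries (Fin 2) ℝ}
    {r s : ℕ} (hr : 4 < r) (hs : 4 < s) {e b a α β γ δ : ℝ}
    (hF : toRealSeries f = C e * (u ^ 2 * v ^ 2) + C b * u ^ r + C a * v ^ s)
    (hu : u - (C α * X 0 + C β * X 1) ∈ varIdeal ℝ ^ 2)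
    (hv : v - (C γ * X 0 + C δ * X 1) ∈ varIdeal ℝ ^ 2) :
    MvPolynomial.map (algebraMap ℚ ℝ) (jet f 4) = MvPolynomial.C e *
      ((MvPolynomial.C α * MvPolynomial.X 0 + MvPolynomial.C β * MvPolynomial.X 1) *
        (MvPolynomial.C γ * MvPolynomial.X 0 + MvPolynomial.C δ * MvPolynomial.X 1)) ^ 2 := by
  set p : MvPolynomial (Fin 2) ℝ := MvPolynomial.C e *
      ((MvPolynomial.C α * MvPolynomial.X 0 + MvPolynomial.C β * MvPolynomial.X 1) *
        (MvPolynomial.C γ * MvPolynomial.X 0 + MvPolynomial.C δ * MvPolynomial.X 1)) ^ 2 with hp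
  have hhom : p.IsHomogeneous 4 := by
    have h (x y : ℝ) : (MvPolynomial.C x * MvPolynomial.X 0 + MvPolynomial.C y * MvPolynomial.X 1 :
        MvPolynomial (Fin 2) ℝ).IsHomogeneous 1 :=
      (MvPolynomial.isHomogeneous_C_mul_X _ _).add (MvPolynomial.isHomogeneous_C_mul_X _ _)
    simpa using (MvPolynomial.isHomogeneous_C (Fin 2) e).mul (((h α β).mul (h γ δ)).pow 2)
  have hlin (x y : ℝ) : C x * X 0 + C y * X 1 ∈ varIdeal ℝ := mem_varIdeal_iff.2 (by simp)
  have hmem {w : MvPowerSeries (Fin 2) ℝ} {x y : ℝ}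
      (hw : w - (C x * X 0 + C y * X 1) ∈ varIdeal ℝ ^ 2) : w ∈ varIdeal ℝ := by
    simpa using add_mem (Ideal.pow_le_self two_ne_zero hw) (hlin x y)
  -- Replacing u, v by their linear parts changes u²v² only from degree 5 on, and r, s > 4.
  have hI : toRealSeries f - (p : MvPowerSeries (Fin 2) ℝ) ∈ varIdeal ℝ ^ 5 := by
    have hexp : toRealSeries f - (p : MvPowerSeries (Fin 2) ℝ)
        = C e * ((u * (v - (C γ * X 0 + C δ * X 1))
            + (C γ * X 0 + C δ * X 1) * (u - (C α * X 0 + C β * X 1)))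
          * (u * v + (C α * X 0 + C β * X 1) * (C γ * X 0 + C δ * X 1)))
          + C b * u ^ r + C a * v ^ s := by
      rw [hF, hp]
      push_cast
      ring
    rw [hexp]
    refine add_mem (add_mem (Ideal.mul_mem_left _ _ ?_) (Ideal.mul_mem_left _ _ ?_))
      (Ideal.mul_mem_left _ _ ?_)
    · rw [show varIdeal ℝ ^ 5 = varIdeal ℝ * varIdeal ℝ ^ 2 * (varIdeal ℝ * varIdeal ℝ) by ring]
      exact Ideal.mul_mem_mul (add_mem (Ideal.mul_mem_mul (hmem hu) hv)
        (Ideal.mul_mem_mul (hlin _ _) hu))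
        (add_mem (Ideal.mul_mem_mul (hmem hu) (hmem hv)) (Ideal.mul_mem_mul (hlin _ _) (hlin _ _)))
    · exact Ideal.pow_le_pow_right hr (Ideal.pow_mem_pow (hmem hu) r)
    · exact Ideal.pow_le_pow_right hs (Ideal.pow_mem_pow (hmem hv) s)
  ext d
  rw [MvPolynomial.coeff_map, coeff_jet]
  split_ifs with hd
  · have := coeff_of_lt_order (d := d)
      (lt_of_lt_of_le (by exact_mod_cast Nat.lt_succ_of_le hd) (le_order_of_mem_varIdeal_pow hI))
    rw [map_sub, sub_eq_zero] at this
    simpa [toRealSeries, MvPolynomial.coeff_map] using this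
  · rw [map_zero, hhom.coeff_eq_zero]
    omega

theorem C_linear_map_sub_mem {L : Type*} [Field L] {τ₁ τ₂ : ℝ →+* L}
    {u v : MvPowerSeries (Fin 2) ℝ} {α β γ δ : ℝ}
    (hu : u - (C α * X 0 + C β * X 1) ∈ varIdeal ℝ ^ 2)
    (hv : v - (C γ * X 0 + C δ * X 1) ∈ varIdeal ℝ ^ 2) (hα : α ≠ 0) (hγ : γ ≠ 0)
    (hτ : τ₁ (β / α) = τ₂ (δ / γ)) :
    map τ₁ u - C (τ₁ α / τ₂ γ) * map τ₂ v ∈ varIdeal L ^ 2 := by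
  have hmap (τ : ℝ →+* L) {w} (hw : w ∈ varIdeal ℝ ^ 2) : map τ w ∈ varIdeal L ^ 2 :=
    map_varIdeal_pow_le (map τ) (by rw [map_X]; exact Ideal.subset_span (by simp))
      (by rw [map_X]; exact Ideal.subset_span (by simp)) hw
  have hα' : τ₁ α ≠ 0 := by simpa using hα
  have hγ' : τ₂ γ ≠ 0 := by simpa using hγ
  have h0 : (C (τ₁ α) : MvPowerSeries (Fin 2) L) = C (τ₁ α / τ₂ γ) * C (τ₂ γ) := by
    rw [← map_mul, div_mul_cancel₀ _ hγ']
  have h1 : (C (τ₁ β) : MvPowerSeries (Fin 2) L) = C (τ₁ α / τ₂ γ) * C (τ₂ δ) := by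
    rw [← map_mul]
    congr 1
    rw [map_div₀, map_div₀] at hτ
    field_simp at hτ ⊢
    linear_combination hτ
  have := sub_mem (hmap τ₁ hu) (Ideal.mul_mem_left _ (C (τ₁ α / τ₂ γ)) (hmap τ₂ hv))
  simp only [map_sub, map_add, map_mul, map_C, map_X] at this
  convert this using 1
  linear_combination X 0 * h0 + X 1 * h1

end MainType

theorem mainTheorem1 (f : MvPolynomial (Fin 2) ℚ) (r s : ℕ)
    (hf : IsRealMainTypeY r s (toRealSeries f))
    (hjet : ¬ FactorsIntoLinear (jet f 4)) :
    r = s ∧ IsRealMainTypeY r r (toRealSeries f) := by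
  suffices h : r = s from ⟨h, by rwa [← h] at hf⟩
  obtain ⟨hr, hs, ε₁, ε₂, a, hε₁, hε₂, ha, φ, hφ⟩ := hf
  obtain ⟨e, he, rfl⟩ : ∃ e : ℚ, e ≠ 0 ∧ ε₁ = e := by
    rcases hε₁ with rfl | rfl
    · exact ⟨1, one_ne_zero, by simp⟩
    · exact ⟨-1, by simp, by simp⟩
  have hb : ε₂ ≠ 0 := by rcases hε₂ with rfl | rfl <;> simp
  set u := φ.symm (MvPowerSeries.X 0) with hu
  set v := φ.symm (MvPowerSeries.X 1) with hv
  have hφC (c : ℝ) : φ.symm (MvPowerSeries.C c) = MvPowerSeries.C c := φ.symm.commutes c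
  have hF : toRealSeries f = MvPowerSeries.C (e : ℝ) * (u ^ 2 * v ^ 2)
      + MvPowerSeries.C ε₂ * u ^ r + MvPowerSeries.C a * v ^ s := by
    rw [← φ.symm_apply_apply (toRealSeries f), hφ, normalFormY]
    push_cast
    simp only [map_add, map_mul, map_pow, hφC, ← hu, ← hv]
    ring
  obtain ⟨α, β, hαβ⟩ := exists_linear_part (constantCoeff_algEquiv_X φ.symm 0)
  obtain ⟨γ, δ, hγδ⟩ := exists_linear_part (constantCoeff_algEquiv_X φ.symm 1)
  obtain ⟨hα, hγ, hirr, P, Q, hadd, hmul⟩ :=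
    conjugate_slopes_of_not_factorsIntoLinear he (map_jet_four_eq hr hs hF hαβ hγδ) hjet
  obtain ⟨L, _, τ₁, τ₂, h₁, h₂⟩ := exists_conjugate_embeddings hadd hmul hirr
  have : CharZero L := charZero_of_injective_ringHom τ₁.injective
  refine exponents_eq_of_swap τ₁ τ₂ φ hr hs (e := (e : ℝ)) (by exact_mod_cast he) hb ha
    (by rw [map_ratCast, map_ratCast]) (φ.apply_symm_apply _) (φ.apply_symm_apply _) hF ?_
    (div_ne_zero (by simpa using hα) (by simpa using hγ))
    (div_ne_zero (by simpa using hγ) (by simpa using hα))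
    (C_linear_map_sub_mem hαβ hγδ hα hγ h₁) (C_linear_map_sub_mem hγδ hαβ hγ hα h₂)
  ext d
  simp [toRealSeries, MvPolynomial.coeff_map]
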